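/- For a finite set $A\subseteq\mathbb{Z}$ and $h\ge 1$, let $hA=\{a_1+\cdots+a_h : a_1,\ldots,a_h\in A\}$ denote the $h$-fold sumset. For $H\in\mathbb{N}$, let $\kappa(H)$ be the smallest natural number $k$ such that for each choice of signs $\epsilon_1,\ldots,\epsilon_H\in\{-,+\}$ there are sets $A,B\subseteq\mathbb{Z}$, each of size at most $k$, such that $|hA|-|hB|$ has the same (strict) sign as $\epsilon_h$ for each $1\le h\le H$. Then $\kappa(H)$ is well defined (such a $k$ exists) for every $H\ge 3$, and there are absolute constants $c,C>0$ such that for every $H\ge 3$, $$c\sqrt{\frac{H}{\log H}}\ \le\ \kappa(H)\ \le\ C\,H.$$ -/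

import Mathlib

/-- The `h`-fold sumset `hA = {a₁ + ⋯ + a_h : a₁, …, a_h ∈ A}` of a finite set of integers. -/
def hFoldSumset (h : ℕ) (A : Finset ℤ) : Finset ℤ :=
  (Fintype.piFinset fun _ : Fin h => A).image fun a => ∑ i, a i

/-- For each choice of signs `ε₁, …, ε_H ∈ {-1, 1}` there are sets `A, B ⊆ ℤ`, each of size at
most `k`, such that `|hA| - |hB|` has the same sign as `ε_h` for each `1 ≤ h ≤ H`.
(Only the values of `ε` on `{1, …, H}` matter; the elements of `ℤˣ` are `1` and `-1`.) -/
def RealizesAllSigns (H k : ℕ) : Prop :=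
  ∀ ε : ℕ → ℤˣ, ∃ A B : Finset ℤ, A.card ≤ k ∧ B.card ≤ k ∧
    ∀ h : ℕ, 1 ≤ h → h ≤ H →
      Int.sign (((hFoldSumset h A).card : ℤ) - ((hFoldSumset h B).card : ℤ)) = (ε h : ℤ)

/-- `κ(H)`: the smallest `k` such that all sign patterns of length `H` are realized by sets of
size at most `k`. -/
noncomputable def kappa (H : ℕ) : ℕ :=
  sInf {k : ℕ | RealizesAllSigns H k}

open Finset Pointwise

/-! Upper bound: thickening a set with consecutive gaps `g` by `[0, h]` gives size `h + 1 + ∑ min g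
(h + 1)`, and choosing gap multiplicities by second differences makes two such sums differ by
exactly `±1` as prescribed. To turn thickenings into sumsets, put `S` at height `3` (in units of
`N`) over `{0, 1}` at height `0`, with `T₁`, `T₂` at heights `2`, `4`. If `T₁ + T₂` absorbs `S + S`
and `S + Tᵢ` does not depend on `S`, then `S` affects the size of the `(h + 1)`-fold sumset only
through `S + h{0, 1}` (`exists_card_hFoldSumset_eq_add`). All pieces have `O(H)` elements.

Lower bound: the sizes `|hA|`, `h ≤ H`, depend only on which vectors in `[-H, H]^k` annihilate an
enumeration of `A`. These are the box points of a subspace spanned by at most `k` of them, so there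
are at most `(2H + 1)^(k²) + 1` size profiles, and pairs of profiles must account for `2^H` sign
patterns. -/

theorem hFoldSumset_zero (A : Finset ℤ) : hFoldSumset 0 A = 0 := by
  ext x
  simp [hFoldSumset]

theorem hFoldSumset_succ (h : ℕ) (A : Finset ℤ) :
    hFoldSumset (h + 1) A = A + hFoldSumset h A := by
  ext x
  simp only [hFoldSumset, mem_image, Fintype.mem_piFinset, mem_add]
  constructor
  · rintro ⟨a, ha, rfl⟩
    exact ⟨a 0, ha 0, _, ⟨fun i => a i.succ, fun i => ha _, rfl⟩, (Fin.sum_univ_succ a).symm⟩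
  · rintro ⟨y, hy, _, ⟨a, ha, rfl⟩, rfl⟩
    exact ⟨Fin.cons y a, Fin.cases hy ha, by simp [Fin.sum_univ_succ]⟩

theorem hFoldSumset_eq_nsmul (h : ℕ) (A : Finset ℤ) : hFoldSumset h A = h • A := by
  induction h with
  | zero => rw [hFoldSumset_zero, zero_nsmul]
  | succ h ih => rw [hFoldSumset_succ, ih, succ_nsmul']

/-- Two summands from `S` can be traded for two from `C`, so at most one is ever needed. -/
theorem nsmul_union_of_add_self_subset {C S : Finset ℤ} (hS : S + S ⊆ C + C) (h : ℕ) :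
    (h + 1) • (C ∪ S) = (h + 1) • C ∪ (S + h • C) := by
  induction h with
  | zero => simp
  | succ h ih =>
    have h1 : S + (S + h • C) ⊆ (h + 1 + 1) • C := by
      rw [← add_assoc, succ_nsmul', succ_nsmul', ← add_assoc]
      exact add_subset_add_right hS
    have h2 : C + (S + h • C) = S + (h + 1) • C := by
      rw [succ_nsmul', add_left_comm]
    rw [succ_nsmul' (C ∪ S), ih, union_add, add_union, add_union, h2, ← succ_nsmul']
    ext x
    have := @h1 x
    simp only [mem_union]
    tauto

theorem nsmul_union (U T : Finset ℤ) (n : ℕ) :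
    (n + 1) • (U ∪ T) = (n + 1) • U ∪ (T + n • (U ∪ T)) := by
  induction n with
  | zero => simp
  | succ n ih =>
    have h1 : T + (n + 1) • U ⊆ T + (n + 1) • (U ∪ T) :=
      add_subset_add_left (nsmul_subset_nsmul_left subset_union_left)
    have h2 : (U ∪ T) + (T + n • (U ∪ T)) = T + (n + 1) • (U ∪ T) := by
      rw [succ_nsmul', add_left_comm]
    have h3 : (n + 1 + 1) • (U ∪ T) =
        (U + (n + 1) • U ∪ (T + (n + 1) • U)) ∪ ((U ∪ T) + (T + n • (U ∪ T))) := by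
      rw [succ_nsmul', ← union_add, ← add_union, ← ih]
    rw [h3, h2, ← succ_nsmul']
    ext x
    have := @h1 x
    simp only [mem_union]
    tauto

theorem nsmul_zero_one (n : ℕ) : n • ({0, 1} : Finset ℤ) = Icc 0 (n : ℤ) := by
  induction n with
  | zero => simp; rfl
  | succ n ih =>
    rw [succ_nsmul', ih]
    ext x
    simp only [mem_add, mem_insert, mem_singleton, mem_Icc]
    constructor
    · rintro ⟨y, rfl | rfl, z, hz, rfl⟩ <;> push_cast <;> omega
    · intro hx
      by_cases h : x = 0
      · exact ⟨0, by simp, 0, by omega, by omega⟩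
      · exact ⟨1, by simp, x - 1, by push_cast at hx; omega, by omega⟩

/-- If a set of height `3` doubles into the even heights and its sums with the even-height part do
not depend on it, its contribution to the `(h + 1)`-fold sumset is its thickening by `[0, h]`. -/
theorem exists_card_hFoldSumset_eq_add (N X H : ℕ) (hN : H * X < N) (hX : 1 ≤ X) {T₁ T₂ : Finset ℤ}
    (hT₁ : T₁ ⊆ Icc 0 (X : ℤ)) (hT₂ : T₂ ⊆ Icc 0 (X : ℤ)) {Y₁ Y₂ : Finset ℤ} (h : ℕ) (hh : h < H) :
    ∃ W : Finset ℤ, ∀ S : Finset ℤ, S ⊆ Icc 0 (X : ℤ) → S + S ⊆ T₁ + T₂ →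
      S + T₁ = Y₁ → S + T₂ = Y₂ →
      (hFoldSumset (h + 1) (({0, 1} ∪ (((2 * N : ℤ) +ᵥ T₁) ∪ ((4 * N : ℤ) +ᵥ T₂))) ∪
        ((3 * N : ℤ) +ᵥ S))).card = W.card + (S + Icc 0 (h : ℤ)).card := by
  set T : Finset ℤ := ((2 * N : ℤ) +ᵥ T₁) ∪ ((4 * N : ℤ) +ᵥ T₂) with hT
  set C : Finset ℤ := {0, 1} ∪ T with hC
  set Y : Finset ℤ := ((5 * N : ℤ) +ᵥ Y₁) ∪ ((7 * N : ℤ) +ᵥ Y₂) with hY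
  -- `Z` collects the sums using `S` and at least one element of `T`; there are none when `h = 0`.
  set Z : Finset ℤ := if h = 0 then ∅ else Y + (h - 1) • C with hZ
  have hNX : (H : ℤ) * X < N := by exact_mod_cast hN
  have hhX : ((h : ℤ) + 1) * X ≤ H * X := by
    gcongr
    exact_mod_cast hh
  have hX' : (1 : ℤ) ≤ X := by exact_mod_cast hX
  have memT {x : ℤ} (hx : x ∈ T) : ∃ j y : ℤ, 1 ≤ j ∧ 0 ≤ y ∧ y ≤ X ∧ x = 2 * N * j + y := by
    simp only [hT, mem_union, mem_vadd_finset, vadd_eq_add] at hx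
    rcases hx with ⟨y, hy, rfl⟩ | ⟨y, hy, rfl⟩
    · have := mem_Icc.1 (hT₁ hy)
      exact ⟨1, y, by omega, this.1, this.2, by ring⟩
    · have := mem_Icc.1 (hT₂ hy)
      exact ⟨2, y, by omega, this.1, this.2, by ring⟩
  have memC {x : ℤ} (hx : x ∈ C) : ∃ j y : ℤ, 0 ≤ j ∧ 0 ≤ y ∧ y ≤ X ∧ x = 2 * N * j + y := by
    simp only [hC, mem_union, mem_insert, mem_singleton] at hx
    rcases hx with (rfl | rfl) | hx
    · exact ⟨0, 0, by omega, by omega, by omega, by ring⟩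
    · exact ⟨0, 1, by omega, by omega, by omega, by ring⟩
    · obtain ⟨j, y, h1, h2⟩ := memT hx
      exact ⟨j, y, by omega, h2⟩
  have memnC (n : ℕ) {x : ℤ} (hx : x ∈ n • C) :
      ∃ j y : ℤ, 0 ≤ j ∧ 0 ≤ y ∧ y ≤ n * X ∧ x = 2 * N * j + y := by
    induction n generalizing x with
    | zero => exact ⟨0, 0, by omega, by omega, by simp, by simpa using hx⟩
    | succ n ih =>
      rw [succ_nsmul'] at hx
      obtain ⟨u, hu, v, hv, rfl⟩ := mem_add.1 hx
      obtain ⟨j, y, h1, h2, h3, rfl⟩ := memC hu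
      obtain ⟨j', y', h1', h2', h3', rfl⟩ := ih hv
      exact ⟨j + j', y + y', by omega, by omega, by push_cast; linarith, by ring⟩
  refine ⟨(h + 1) • C ∪ Z, fun S hS hSS hS₁ hS₂ => ?_⟩
  have hSSC : ((3 * N : ℤ) +ᵥ S) + ((3 * N : ℤ) +ᵥ S) ⊆ C + C := by
    intro x hx
    simp only [mem_add, mem_vadd_finset, vadd_eq_add] at hx
    obtain ⟨_, ⟨a, ha, rfl⟩, _, ⟨b, hb, rfl⟩, rfl⟩ := hx
    obtain ⟨u, hu, v, hv, huv⟩ := mem_add.1 (hSS (add_mem_add ha hb))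
    refine mem_add.2 ⟨2 * N + u, ?_, 4 * N + v, ?_, by linarith⟩
    · exact mem_union_right _ (mem_union_left _ (mem_vadd_finset.2 ⟨u, hu, rfl⟩))
    · exact mem_union_right _ (mem_union_right _ (mem_vadd_finset.2 ⟨v, hv, rfl⟩))
  have hST : ((3 * N : ℤ) +ᵥ S) + T = Y := by
    have key (a b : ℤ) (P Q : Finset ℤ) : (a +ᵥ P) + (b +ᵥ Q) = (a + b) +ᵥ (P + Q) := by
      rw [vadd_add_assoc, add_vadd_comm, vadd_vadd]
    rw [hT, add_union, key, key, hS₁, hS₂, hY]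
    ring_nf
  have hSnC : ((3 * N : ℤ) +ᵥ S) + h • C = ((3 * N : ℤ) +ᵥ (S + Icc 0 (h : ℤ))) ∪ Z := by
    rcases h with _ | n
    · simp only [zero_nsmul, add_zero, hZ, if_true, union_empty, Nat.cast_zero, Icc_self]
      exact congrArg _ (add_zero S).symm
    · rw [hC, nsmul_union, ← hC, add_union, ← add_assoc, hST, nsmul_zero_one, vadd_add_assoc, hZ]
      simp
  -- The thickened `S` lies in `[3N, 4N)`; sums from `C` have remainder below `N` modulo `2N`, and
  -- `Z` starts at `5N`.
  have hdisj : Disjoint ((h + 1) • C ∪ Z) ((3 * N : ℤ) +ᵥ (S + Icc 0 (h : ℤ))) := by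
    rw [Finset.disjoint_left]
    intro x hx hx'
    simp only [mem_add, mem_vadd_finset, vadd_eq_add, mem_Icc] at hx'
    obtain ⟨_, ⟨a, ha, b, hb, rfl⟩, rfl⟩ := hx'
    have ha' := mem_Icc.1 (hS ha)
    have hhX' : (h : ℤ) ≤ h * X := by nlinarith
    have hlt : a + b < N := by linarith
    rcases mem_union.1 hx with hx | hx
    · obtain ⟨j, y, h1, h2, h3, h4⟩ := memnC _ hx
      push_cast at h3
      have h5 : y < N := by linarith
      rcases le_or_gt j 1 with hj | hj
      · nlinarith
      · have : (2 : ℤ) ≤ j := hj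
        nlinarith
    · rw [hZ] at hx
      split_ifs at hx
      · simp at hx
      · rw [← hST] at hx
        obtain ⟨_, h1, v, hv, huv⟩ := mem_add.1 hx
        obtain ⟨_, hs, t, ht, rfl⟩ := mem_add.1 h1
        obtain ⟨s, hsS, rfl⟩ := mem_vadd_finset.1 hs
        obtain ⟨j, y, h1, h2, h3, rfl⟩ := memT ht
        obtain ⟨j', y', h1', h2', h3', rfl⟩ := memnC _ hv
        have hs' := mem_Icc.1 (hS hsS)
        simp only [vadd_eq_add] at huv
        have : (0 : ℤ) ≤ N * j' := by positivity
        nlinarith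
  rw [hFoldSumset_eq_nsmul, nsmul_union_of_add_self_subset hSSC, hSnC,
    union_comm (_ +ᵥ _) Z, ← union_assoc, card_union_of_disjoint hdisj, card_vadd_finset]

/-! ### Sets with prescribed gaps and their thickenings -/

/-- The set of partial sums of a list of gaps, including the empty sum. -/
def gapSet : List ℕ → Finset ℤ
  | [] => {0}
  | g :: l => insert 0 ((g : ℤ) +ᵥ gapSet l)

theorem zero_mem_gapSet (l : List ℕ) : 0 ∈ gapSet l := by
  cases l <;> simp [gapSet]

theorem card_gapSet_le (l : List ℕ) : (gapSet l).card ≤ l.length + 1 := by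
  induction l with
  | nil => simp [gapSet]
  | cons g l ih =>
    refine (card_insert_le _ _).trans ?_
    rw [card_vadd_finset]
    simpa using ih

theorem gapSet_subset (l : List ℕ) : gapSet l ⊆ Icc 0 (l.sum : ℤ) := by
  induction l with
  | nil => simp [gapSet]
  | cons g l ih =>
    intro x hx
    simp only [gapSet, mem_insert, mem_vadd_finset, vadd_eq_add] at hx
    rw [mem_Icc, List.sum_cons, Nat.cast_add]
    rcases hx with rfl | ⟨y, hy, rfl⟩
    · exact ⟨le_rfl, by positivity⟩
    · have := mem_Icc.1 (ih hy)
      omega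

theorem gapSet_append (l₁ l₂ : List ℕ) :
    gapSet (l₁ ++ l₂) = gapSet l₁ ∪ ((l₁.sum : ℤ) +ᵥ gapSet l₂) := by
  induction l₁ with
  | nil =>
    simp [gapSet, zero_mem_gapSet]
  | cons g l ih =>
    simp only [List.cons_append, gapSet, ih, List.sum_cons, insert_union, vadd_finset_union,
      vadd_vadd, Nat.cast_add]

theorem gapSet_replicate_one (m : ℕ) : gapSet (List.replicate m 1) = Icc 0 (m : ℤ) := by
  induction m with
  | zero => simp [gapSet]
  | succ m ih =>
    ext x
    simp only [List.replicate_succ, gapSet, ih, mem_insert, mem_vadd_finset, vadd_eq_add, mem_Icc]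
    constructor
    · rintro (rfl | ⟨y, hy, rfl⟩)
      · exact ⟨le_rfl, by positivity⟩
      · omega
    · intro hx
      push_cast at hx
      by_cases h : x = 0
      · exact Or.inl h
      · exact Or.inr ⟨x - 1, by omega, by push_cast; omega⟩

theorem gapSet_cons_add_Icc (g : ℕ) (l : List ℕ) (h : ℕ) :
    gapSet (g :: l) + Icc 0 (h : ℤ) =
      Ico 0 ((min g (h + 1) : ℕ) : ℤ) ∪ ((g : ℤ) +ᵥ (gapSet l + Icc 0 (h : ℤ))) := by
  ext x
  simp only [gapSet, mem_add, mem_union, mem_Ico, mem_insert, mem_vadd_finset, vadd_eq_add, mem_Icc]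
  constructor
  · rintro ⟨_, rfl | ⟨y, hy, rfl⟩, z, hz, rfl⟩
    · by_cases hg : z < g
      · left
        push_cast
        omega
      · exact Or.inr ⟨z - g, ⟨0, zero_mem_gapSet l, z - g, by omega, by omega⟩, by omega⟩
    · exact Or.inr ⟨y + z, ⟨y, hy, z, hz, rfl⟩, by omega⟩
  · rintro (hx | ⟨_, ⟨y, hy, z, hz, rfl⟩, rfl⟩)
    · push_cast at hx
      exact ⟨0, Or.inl rfl, x, by omega, by omega⟩
    · exact ⟨g + y, Or.inr ⟨y, hy, rfl⟩, z, hz, by omega⟩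

/-- Each point covers `min g (h + 1)` integers before its successor at distance `g`; the last point
covers `h + 1`. -/
theorem card_gapSet_add_Icc (l : List ℕ) (h : ℕ) :
    (gapSet l + Icc 0 (h : ℤ)).card = h + 1 + (l.map fun g => min g (h + 1)).sum := by
  induction l with
  | nil =>
    have : gapSet [] = 0 := rfl
    rw [this, zero_add]
    simp
  | cons g l ih =>
    rw [gapSet_cons_add_Icc, card_union_of_disjoint, card_vadd_finset, ih, Int.card_Ico,
      List.map_cons, List.sum_cons]
    · omega
    · rw [Finset.disjoint_left]
      intro x hx hx'
      simp only [mem_add, mem_Ico, mem_vadd_finset, vadd_eq_add, mem_Icc] at hx hx'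
      obtain ⟨_, ⟨y, hy, z, hz, rfl⟩, rfl⟩ := hx'
      have := mem_Icc.1 (gapSet_subset l hy)
      push_cast at hx
      omega

theorem gapSet_add_Icc (l : List ℕ) (m : ℕ) (hl : ∀ g ∈ l, g ≤ m) :
    gapSet l + Icc 0 (m : ℤ) = Icc 0 ((l.sum + m : ℕ) : ℤ) := by
  induction l with
  | nil =>
    have : gapSet [] = 0 := rfl
    rw [this, zero_add]
    simp
  | cons g l ih =>
    have hg : g ≤ m := hl g (by simp)
    rw [gapSet_cons_add_Icc, ih fun x hx => hl x (by simp [hx])]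
    ext x
    simp only [mem_union, mem_Ico, mem_vadd_finset, vadd_eq_add, mem_Icc, List.sum_cons,
      Nat.cast_add]
    rw [min_eq_left (by omega)]
    constructor
    · rintro (hx | ⟨y, hy, rfl⟩) <;> omega
    · intro hx
      by_cases h : x < g
      · left; omega
      · exact Or.inr ⟨x - g, by omega, by omega⟩

/-- The multiples `0, m, …, (r - 1) m`. -/
def multiplesBelow (m r : ℕ) : Finset ℤ := (range r).image fun i : ℕ => (m * i : ℤ)

theorem Icc_add_multiplesBelow (m r : ℕ) (hr : 1 ≤ r) :
    Icc 0 (m : ℤ) + multiplesBelow m r = Icc 0 (r * m : ℤ) := by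
  induction r, hr using Nat.le_induction with
  | base =>
    have : multiplesBelow m 1 = 0 := by simp [multiplesBelow]; rfl
    rw [this]
    simp
  | succ r hr ih =>
    have : multiplesBelow m (r + 1) = multiplesBelow m r ∪ {(m * r : ℤ)} := by
      simp [multiplesBelow, range_add_one, image_insert]
    rw [this, add_union, ih]
    ext x
    simp only [mem_union, mem_Icc, mem_add, mem_singleton, exists_eq_left]
    have : (0 : ℤ) ≤ r * m := by positivity
    push_cast
    constructor
    · rintro (hx | ⟨y, hy, rfl⟩) <;> constructor <;> nlinarith
    · intro hx
      by_cases h : x ≤ r * m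
      · left; omega
      · exact Or.inr ⟨x - m * r, ⟨by nlinarith, by nlinarith⟩, by omega⟩

/-- A gap list flanked on both sides by `m` unit gaps. -/
def paddedGaps (m : ℕ) (l : List ℕ) : List ℕ := List.replicate m 1 ++ l ++ List.replicate m 1

theorem sum_paddedGaps (m : ℕ) (l : List ℕ) : (paddedGaps m l).sum = l.sum + 2 * m := by
  simp [paddedGaps]
  omega

/-- The two unit-gap blocks alone sweep out two intervals of length `r * m`, which overlap by `hrm`;
the middle gaps become invisible. -/
theorem gapSet_paddedGaps_add_multiplesBelow (m r : ℕ) (l : List ℕ) (hr : 1 ≤ r)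
    (hrm : l.sum + m ≤ r * m) :
    gapSet (paddedGaps m l) + multiplesBelow m r = Icc 0 ((l.sum + m + r * m : ℕ) : ℤ) := by
  have hI := Icc_add_multiplesBelow m r hr
  have hrm' : (l.sum + m : ℤ) ≤ r * m := by exact_mod_cast hrm
  apply Subset.antisymm
  · intro x hx
    obtain ⟨y, hy, z, hz, rfl⟩ := mem_add.1 hx
    have h1 := mem_Icc.1 (gapSet_subset _ hy)
    rw [sum_paddedGaps] at h1
    simp only [multiplesBelow, mem_image, mem_range] at hz
    obtain ⟨i, hi, rfl⟩ := hz
    have hi' : (i : ℤ) + 1 ≤ r := by exact_mod_cast hi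
    have h2 : (m : ℤ) * i + m ≤ r * m := by nlinarith
    have h3 : (0 : ℤ) ≤ m * i := by positivity
    simp only [mem_Icc, Nat.cast_add, Nat.cast_mul, Nat.cast_ofNat] at h1 ⊢
    omega
  · intro x hx
    have hx' := mem_Icc.1 hx
    simp only [Nat.cast_add, Nat.cast_mul] at hx'
    rw [paddedGaps, gapSet_append, gapSet_append, gapSet_replicate_one, union_add, union_add]
    by_cases h : x ≤ r * m
    · refine mem_union_left _ (mem_union_left _ ?_)
      rw [hI, mem_Icc]
      omega
    · refine mem_union_right _ ?_
      rw [vadd_add_assoc, hI]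
      refine mem_vadd_finset.2 ⟨x - (l.sum + m), mem_Icc.2 (by omega), ?_⟩
      simp
      ring

/-! ### Realizing sign patterns: the upper bound -/

/-- The list in which each gap `g ∈ {1, …, K}` occurs `n g` times. -/
def gapList (n : ℕ → ℕ) : ℕ → List ℕ
  | 0 => []
  | K + 1 => gapList n K ++ List.replicate (n (K + 1)) (K + 1)

theorem sum_map_gapList (n : ℕ → ℕ) (K : ℕ) (f : ℕ → ℕ) :
    ((gapList n K).map f).sum = ∑ g ∈ range K, n (g + 1) * f (g + 1) := by
  induction K with
  | zero => simp [gapList]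
  | succ K ih => simp [gapList, ih, sum_range_succ]

theorem length_gapList (n : ℕ → ℕ) (K : ℕ) :
    (gapList n K).length = ∑ g ∈ range K, n (g + 1) := by
  simpa using sum_map_gapList n K fun _ => 1

theorem le_of_mem_gapList {n : ℕ → ℕ} {K g : ℕ} (hg : g ∈ gapList n K) : g ≤ K := by
  induction K with
  | zero => simp [gapList] at hg
  | succ K ih =>
    rcases List.mem_append.1 hg with hg | hg
    · exact (ih hg).trans (Nat.le_succ K)
    · exact (List.eq_of_mem_replicate hg).le

/-- A sequence is recovered from its second differences by summing against `min g h`. -/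
theorem sum_second_difference_mul_min (D : ℕ → ℤ) (hD : D 0 = 0) (h K : ℕ) (hK : h ≤ K) :
    ∑ g ∈ range K, (2 * D (g + 1) - D g - D (g + 2)) * ((min (g + 1) h : ℕ) : ℤ) =
      D h - h * (D (K + 1) - D K) := by
  induction K, hK using Nat.le_induction with
  | base =>
    have key (K : ℕ) : ∑ g ∈ range K, (2 * D (g + 1) - D g - D (g + 2)) * ((g : ℤ) + 1) =
        D K - K * (D (K + 1) - D K) := by
      induction K with
      | zero => simp [hD]
      | succ K ih =>
        rw [sum_range_succ, ih]
        push_cast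
        ring
    rw [← key h]
    refine sum_congr rfl fun g hg => ?_
    rw [min_eq_left (by simpa using hg)]
    push_cast
    rfl
  | succ K hK ih =>
    rw [sum_range_succ, ih, min_eq_right (by omega)]
    ring

/-- The set with gap list `l` (padded) at height `3` above the auxiliary set `{0, 1}` and two
heights whose sum absorbs the double of the former. -/
noncomputable def layeredSet (N m r : ℕ) (l : List ℕ) : Finset ℤ :=
  ({0, 1} ∪ (((2 * N : ℤ) +ᵥ Icc 0 (m : ℤ)) ∪ ((4 * N : ℤ) +ᵥ multiplesBelow m r))) ∪
    ((3 * N : ℤ) +ᵥ gapSet (paddedGaps m l))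

theorem card_layeredSet_le (N m r : ℕ) (l : List ℕ) :
    (layeredSet N m r l).card ≤ 3 * m + r + l.length + 4 := by
  have h1 : ({0, 1} : Finset ℤ).card ≤ 2 := card_le_two
  have h2 : (multiplesBelow m r).card ≤ r := card_image_le.trans (card_range r).le
  have h3 := card_gapSet_le (paddedGaps m l)
  have h8 : (paddedGaps m l).length = m + (l.length + m) := by simp [paddedGaps]
  have h4 : (Icc 0 (m : ℤ)).card = m + 1 := by simp
  have h5 := card_union_le
    ({0, 1} ∪ (((2 * N : ℤ) +ᵥ Icc 0 (m : ℤ)) ∪ ((4 * N : ℤ) +ᵥ multiplesBelow m r)))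
    ((3 * N : ℤ) +ᵥ gapSet (paddedGaps m l))
  have h6 := card_union_le
    {0, 1} (((2 * N : ℤ) +ᵥ Icc 0 (m : ℤ)) ∪ ((4 * N : ℤ) +ᵥ multiplesBelow m r))
  have h7 := card_union_le ((2 * N : ℤ) +ᵥ Icc 0 (m : ℤ)) ((4 * N : ℤ) +ᵥ multiplesBelow m r)
  simp only [card_vadd_finset] at h5 h6 h7
  rw [layeredSet]
  omega

theorem card_hFoldSumset_layeredSet_sub (N m r H : ℕ) (l l' : List ℕ) (hm : 1 ≤ m) (hr : 1 ≤ r)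
    (hl : ∀ g ∈ l, g ≤ m) (hl' : ∀ g ∈ l', g ≤ m) (hsum : l.sum = l'.sum)
    (hrm : 2 * l.sum + 4 * m ≤ r * m) (hN : H * (r * m) < N) (h : ℕ) (hh : h < H) :
    ((hFoldSumset (h + 1) (layeredSet N m r l)).card : ℤ) -
      (hFoldSumset (h + 1) (layeredSet N m r l')).card =
    (l.map fun g => min g (h + 1)).sum - (l'.map fun g => min g (h + 1)).sum := by
  have hI := Icc_add_multiplesBelow m r hr
  have hT₁ : Icc 0 (m : ℤ) ⊆ Icc 0 ((r * m : ℕ) : ℤ) := by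
    refine Icc_subset_Icc_right ?_
    exact_mod_cast Nat.le_mul_of_pos_left m hr
  have hT₂ : multiplesBelow m r ⊆ Icc 0 ((r * m : ℕ) : ℤ) := by
    intro x hx
    push_cast
    rw [← hI, mem_add]
    exact ⟨0, by simp, x, hx, zero_add x⟩
  obtain ⟨W, hW⟩ := exists_card_hFoldSumset_eq_add N (r * m) H hN (Nat.mul_pos hr hm) hT₁ hT₂
    (Y₁ := Icc 0 ((l.sum + 2 * m + m : ℕ) : ℤ)) (Y₂ := Icc 0 ((l.sum + m + r * m : ℕ) : ℤ)) h hh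
  have key (k : List ℕ) (hk : ∀ g ∈ k, g ≤ m) (hks : k.sum = l.sum) :
      (hFoldSumset (h + 1) (layeredSet N m r k)).card =
        W.card + (h + 1 + (2 * m + (k.map fun g => min g (h + 1)).sum)) := by
    have hsub := gapSet_subset (paddedGaps m k)
    rw [sum_paddedGaps, hks] at hsub
    rw [layeredSet, hW, card_gapSet_add_Icc]
    · simp only [paddedGaps, List.map_append, List.map_replicate, List.sum_append,
        List.sum_replicate, smul_eq_mul]
      rw [min_eq_left (by omega : 1 ≤ h + 1)]
      omega
    · refine hsub.trans (Icc_subset_Icc_right ?_)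
      exact_mod_cast (by omega : l.sum + 2 * m ≤ r * m)
    · rw [hI]
      intro x hx
      obtain ⟨y, hy, z, hz, rfl⟩ := mem_add.1 hx
      have h1 := mem_Icc.1 (hsub hy)
      have h2 := mem_Icc.1 (hsub hz)
      have h3 : (2 * l.sum + 4 * m : ℤ) ≤ r * m := by exact_mod_cast hrm
      simp only [Nat.cast_add, Nat.cast_mul, Nat.cast_ofNat] at h1 h2
      rw [mem_Icc]
      omega
    · rw [gapSet_add_Icc, sum_paddedGaps, hks]
      intro g hg
      simp only [paddedGaps, List.mem_append, List.mem_replicate] at hg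
      rcases hg with (hg | hg) | hg
      · omega
      · exact hk g hg
      · omega
    · rw [gapSet_paddedGaps_add_multiplesBelow m r k hr (by omega), hks]
  rw [key l hl rfl, key l' hl' hsum.symm]
  push_cast
  ring

theorem realizesAllSigns_linear (H : ℕ) : RealizesAllSigns H (35 * (H + 1)) := by
  intro ε
  set D : ℕ → ℤ := fun h => if 1 ≤ h ∧ h ≤ H then (ε h : ℤ) else 0 with hD
  set e : ℕ → ℤ := fun g => 2 * D g - D (g - 1) - D (g + 1) with he
  have hDabs (h : ℕ) : |D h| ≤ 1 := by
    simp only [hD]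
    split_ifs
    · rw [Int.isUnit_iff_abs_eq.1 (ε h).isUnit]
    · simp
  have heabs (g : ℕ) : |e g| ≤ 4 := by
    have h1 := abs_le.1 (hDabs g)
    have h2 := abs_le.1 (hDabs (g - 1))
    have h3 := abs_le.1 (hDabs (g + 1))
    rw [abs_le]
    simp only [he]
    constructor <;> linarith
  -- The shift by `4` makes all multiplicities nonnegative; it is cancelled by the constant
  -- multiplicity `4` in `l'`.
  set n : ℕ → ℕ := fun g => (4 + e g).toNat with hn
  have hn_cast (g : ℕ) : (n g : ℤ) = 4 + e g :=
    Int.toNat_of_nonneg (by linarith [(abs_le.1 (heabs g)).1])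
  have hn_le (g : ℕ) : n g ≤ 8 := by
    have := (abs_le.1 (heabs g)).2
    have := hn_cast g
    omega
  set l := gapList n (H + 1) with hl
  set l' := gapList (fun _ => 4) (H + 1) with hl'
  have hD0 : D 0 = 0 := by simp [hD]
  have hDH : D (H + 1) = 0 := by simp [hD]
  have hDH' : D (H + 2) = 0 := by simp [hD]
  have hmap (h : ℕ) (hh : h ≤ H + 1) :
      ((l.map fun g => min g h).sum : ℤ) - (l'.map fun g => min g h).sum = D h := by
    have := sum_second_difference_mul_min D hD0 h (H + 1) hh
    rw [hDH, hDH', sub_zero, mul_zero, sub_zero] at this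
    rw [← this, hl, hl', sum_map_gapList, sum_map_gapList, Nat.cast_sum, Nat.cast_sum,
      ← sum_sub_distrib]
    refine sum_congr rfl fun g _ => ?_
    rw [Nat.cast_mul, Nat.cast_mul, hn_cast]
    simp only [he, Nat.add_sub_cancel]
    push_cast
    ring
  have hmin (k : List ℕ) (hk : ∀ g ∈ k, g ≤ H + 1) : (k.map fun g => min g (H + 1)).sum = k.sum := by
    conv_rhs => rw [← List.map_id k]
    exact congrArg _ (List.map_congr_left fun g hg => min_eq_left (hk g hg))
  have hlm : ∀ g ∈ l, g ≤ H + 1 := fun g hg => le_of_mem_gapList hg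
  have hlm' : ∀ g ∈ l', g ≤ H + 1 := fun g hg => le_of_mem_gapList hg
  -- Since `D (H + 1) = 0` and no gap exceeds `H + 1`, the full sums agree.
  have hsum : l.sum = l'.sum := by
    have := hmap (H + 1) le_rfl
    rw [hmin l hlm, hmin l' hlm', hDH] at this
    omega
  have hlen : l.length ≤ 8 * (H + 1) := by
    rw [hl, length_gapList]
    refine (sum_le_card_nsmul _ _ 8 fun g _ => hn_le _).trans (le_of_eq ?_)
    simp [mul_comm]
  have hlen' : l'.length ≤ 8 * (H + 1) := by
    rw [hl', length_gapList]
    simp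
    omega
  have hlsum : l.sum ≤ 8 * (H + 1) * (H + 1) :=
    (List.sum_le_card_nsmul l (H + 1) hlm).trans (Nat.mul_le_mul_right (H + 1) hlen)
  set m := H + 1 with hm
  -- Chosen so that `2 * l.sum + 4 * m ≤ r * m`, given `l.sum ≤ 8 * m * m`.
  set r := 16 * m + 4 with hr
  set N := H * (r * m) + 1 with hN
  refine ⟨layeredSet N m r l, layeredSet N m r l', ?_, ?_, fun h h1 hH => ?_⟩
  · have := card_layeredSet_le N m r l
    omega
  · have := card_layeredSet_le N m r l'
    omega
  · obtain ⟨h, rfl⟩ := Nat.exists_eq_add_of_le' h1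
    rw [card_hFoldSumset_layeredSet_sub N m r H l l' (by omega) (by omega) hlm hlm' hsum
      (by rw [hr]; nlinarith) (by omega) h (by omega), hmap (h + 1) (by omega)]
    simp only [hD, h1, hH, and_self, if_true]
    rcases Int.units_eq_one_or (ε (h + 1)) with h | h <;> simp [h]

/-! ### Counting size profiles: the lower bound -/

theorem card_image_le_card_image_of_kernel {α β γ : Type*} [DecidableEq β] [DecidableEq γ]
    (s : Finset α) (φ : α → β) (ψ : α → γ)
    (h : ∀ x ∈ s, ∀ y ∈ s, ψ x = ψ y → φ x = φ y) : (s.image φ).card ≤ (s.image ψ).card := by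
  classical
  rcases s.eq_empty_or_nonempty with rfl | ⟨x₀, -⟩
  · simp
  have hex : ∀ c ∈ s.image ψ, ∃ x ∈ s, ψ x = c := fun c hc => by simpa using hc
  refine card_le_card_of_surjOn
    (fun c => if hc : c ∈ s.image ψ then φ (hex c hc).choose else φ x₀) ?_
  intro b hb
  obtain ⟨x, hx, rfl⟩ := mem_image.1 hb
  have hc : ψ x ∈ s.image ψ := mem_image_of_mem ψ hx
  refine ⟨ψ x, hc, ?_⟩
  have := (hex _ hc).choose_spec
  simp only [dif_pos hc]
  exact h _ this.1 _ hx this.2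

theorem hFoldSumset_image_univ {k : ℕ} (a : Fin k → ℤ) (h : ℕ) :
    hFoldSumset h (univ.image a) = univ.image fun f : Fin h → Fin k => ∑ i, a (f i) := by
  ext x
  simp only [hFoldSumset, mem_image, Fintype.mem_piFinset, mem_univ, true_and]
  constructor
  · rintro ⟨b, hb, rfl⟩
    choose f hf using hb
    exact ⟨f, by simp [hf]⟩
  · rintro ⟨f, rfl⟩
    exact ⟨fun i => a (f i), fun i => ⟨f i, rfl⟩, rfl⟩

/-- Coefficient vectors of length `k` with entries in `[-H, H]`. -/
abbrev CoeffBox (H k : ℕ) : Type := Fin k → ↥(Finset.Icc (-(H : ℤ)) H)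

/-- Two `h`-fold sums coincide exactly when the difference of their multiplicity vectors, which lies
in the box, is a relation. -/
theorem card_hFoldSumset_eq_of_relations {H k : ℕ} {a b : Fin k → ℤ}
    (hab : ∀ v : CoeffBox H k, ∑ j, (v j : ℤ) * a j = 0 ↔ ∑ j, (v j : ℤ) * b j = 0)
    {h : ℕ} (hh : h ≤ H) :
    (hFoldSumset h (univ.image a)).card = (hFoldSumset h (univ.image b)).card := by
  have hfib (c : Fin k → ℤ) (f : Fin h → Fin k) :
      ∑ i, c (f i) = ∑ j, ((univ.filter fun i => f i = j).card : ℤ) * c j := by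
    rw [← sum_fiberwise univ f fun i => c (f i)]
    refine sum_congr rfl fun j _ => ?_
    rw [sum_congr rfl (g := fun _ => c j), sum_const, nsmul_eq_mul]
    intro i hi
    rw [(mem_filter.1 hi).2]
  have hle (f : Fin h → Fin k) (j : Fin k) : (univ.filter fun i => f i = j).card ≤ H :=
    (card_le_univ _).trans (by simpa using hh)
  have hker (f g : Fin h → Fin k) : (∑ i, a (f i) = ∑ i, a (g i)) ↔
      ∑ i, b (f i) = ∑ i, b (g i) := by
    have := hab fun j => ⟨((univ.filter fun i => f i = j).card : ℤ) -
      (univ.filter fun i => g i = j).card, by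
        have h1 := hle f j
        have h2 := hle g j
        rw [mem_Icc]
        omega⟩
    simp only [sub_mul, sum_sub_distrib, ← hfib, sub_eq_zero] at this
    exact this
  rw [hFoldSumset_image_univ, hFoldSumset_image_univ]
  apply le_antisymm <;> apply card_image_le_card_image_of_kernel
  · exact fun f _ g _ => (hker f g).2
  · exact fun f _ g _ => (hker f g).1

/-- The rational span of a tuple of integer coefficient vectors. -/
def relationSpan {H k : ℕ} (w : Fin k → CoeffBox H k) : Submodule ℚ (Fin k → ℚ) :=
  Submodule.span ℚ (Set.range fun i j => ((w i j : ℤ) : ℚ))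

/-- A basis of the span of the relations can be picked among them; conversely the span stays in the
kernel of `v ↦ v · a`. -/
theorem exists_relationSpan (H k : ℕ) (a : Fin k → ℤ) :
    ∃ w : Fin k → CoeffBox H k, ∀ v : CoeffBox H k,
      ∑ j, (v j : ℤ) * a j = 0 ↔ (fun j => ((v j : ℤ) : ℚ)) ∈ relationSpan w := by
  set toRat : CoeffBox H k → Fin k → ℚ := fun v j => ((v j : ℤ) : ℚ) with htoRat
  set R : Set (Fin k → ℚ) := toRat '' {v | ∑ j, (v j : ℤ) * a j = 0} with hR
  obtain ⟨f, hfR, hf, -⟩ := Submodule.exists_fun_fin_finrank_span_eq ℚ R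
  have hrank : Module.finrank ℚ (Submodule.span ℚ R) ≤ k := by
    simpa using Submodule.finrank_le (Submodule.span ℚ R)
  choose u hu huf using hfR
  -- Zero vectors pad the basis to exactly `k` entries.
  let z : CoeffBox H k := fun _ => ⟨0, by simp⟩
  refine ⟨fun i => if hi : (i : ℕ) < Module.finrank ℚ (Submodule.span ℚ R) then u ⟨i, hi⟩ else z,
    fun v => ?_⟩
  set w : Fin k → CoeffBox H k :=
    fun i => if hi : (i : ℕ) < Module.finrank ℚ (Submodule.span ℚ R) then u ⟨i, hi⟩ else z with hw
  constructor
  · intro hv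
    have h1 : toRat v ∈ Submodule.span ℚ (Set.range f) := by
      rw [hf]
      exact Submodule.subset_span ⟨v, hv, rfl⟩
    refine Submodule.span_mono ?_ h1
    rintro _ ⟨i, rfl⟩
    refine ⟨⟨i, i.2.trans_le hrank⟩, ?_⟩
    rw [← huf i]
    simp [hw, htoRat]
  · intro hv
    let φ : (Fin k → ℚ) →ₗ[ℚ] ℚ := ∑ j, (a j : ℚ) • LinearMap.proj j
    have hφ (v : CoeffBox H k) : φ (toRat v) = ((∑ j, (v j : ℤ) * a j : ℤ) : ℚ) := by
      simp [φ, htoRat, mul_comm]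
    have hle : relationSpan w ≤ LinearMap.ker φ := by
      refine Submodule.span_le.2 ?_
      rintro _ ⟨i, rfl⟩
      change φ (toRat (w i)) = 0
      rw [hφ]
      by_cases hi : (i : ℕ) < Module.finrank ℚ (Submodule.span ℚ R)
      · have := hu ⟨i, hi⟩
        simp only [hw, dif_pos hi]
        exact_mod_cast this
      · simp [hw, dif_neg hi, z]
    have h0 : φ (toRat v) = 0 := hle hv
    rw [hφ] at h0
    exact_mod_cast h0

/-- The sumset sizes of sets of at most `k` integers up to index `H` are determined by `k`
coefficient vectors. -/
theorem exists_sumset_code (H k : ℕ) :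
    ∃ c : Finset ℤ → Option (Fin k → CoeffBox H k), ∀ A B : Finset ℤ, A.card ≤ k → B.card ≤ k →
      c A = c B → ∀ h ≤ H, (hFoldSumset h A).card = (hFoldSumset h B).card := by
  classical
  have henum (A : Finset ℤ) : ∃ a : Fin k → ℤ, A.Nonempty → A.card ≤ k → univ.image a = A := by
    by_cases hA : A.Nonempty ∧ A.card ≤ k
    · obtain ⟨⟨x, hx⟩, hk⟩ := hA
      refine ⟨fun i => if hi : (i : ℕ) < A.card then A.equivFin.symm ⟨i, hi⟩ else x, fun _ _ => ?_⟩
      ext y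
      simp only [mem_image, mem_univ, true_and]
      constructor
      · rintro ⟨i, rfl⟩
        split_ifs
        · exact Subtype.property _
        · exact hx
      · intro hy
        refine ⟨⟨A.equivFin ⟨y, hy⟩, (A.equivFin ⟨y, hy⟩).2.trans_le hk⟩, ?_⟩
        simp
    · exact ⟨0, fun h1 h2 => absurd ⟨h1, h2⟩ hA⟩
  choose a ha using henum
  choose w hw using fun A => exists_relationSpan H k (a A)
  -- The empty set is not the image of a `k`-tuple when `k > 0`, hence the extra code `none`.
  refine ⟨fun A => if A.Nonempty then some (w A) else none, fun A B hA hB hAB h hh => ?_⟩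
  rcases A.eq_empty_or_nonempty with rfl | hA' <;> rcases B.eq_empty_or_nonempty with rfl | hB'
  · rfl
  · simp [hB'] at hAB
  · simp [hA'] at hAB
  · simp only [hA', hB', if_true, Option.some.injEq] at hAB
    rw [← ha A hA' hA, ← ha B hB' hB]
    exact card_hFoldSumset_eq_of_relations (fun v => by rw [hw A, hw B, hAB]) hh

theorem two_pow_le_of_realizesAllSigns {H k : ℕ} (hk : RealizesAllSigns H k) :
    2 ^ H ≤ ((2 * H + 1) ^ (k * k) + 1) ^ 2 := by
  classical
  obtain ⟨c, hc⟩ := exists_sumset_code H k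
  have hex (ε : Fin H → ℤˣ) :=
    hk fun h => if hh : 1 ≤ h ∧ h ≤ H then ε ⟨h - 1, by omega⟩ else 1
  choose A B hA hB hAB using hex
  have hinj : Function.Injective fun ε => (c (A ε), c (B ε)) := by
    intro ε ε' h
    rw [Prod.mk.injEq] at h
    funext i
    have h1 := hAB ε (i + 1) (by omega) (by omega)
    have h2 := hAB ε' (i + 1) (by omega) (by omega)
    rw [hc _ _ (hA ε) (hA ε') h.1 _ (by omega), hc _ _ (hB ε) (hB ε') h.2 _ (by omega), h2] at h1
    have hi : 1 ≤ (i : ℕ) + 1 ∧ (i : ℕ) + 1 ≤ H := by omega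
    simp only [dif_pos hi, Nat.add_sub_cancel, Fin.eta] at h1
    exact (Units.ext h1).symm
  have hcard := Fintype.card_le_of_injective _ hinj
  have hbox : ((H : ℤ) + 1 + (H : ℤ)).toNat = 2 * H + 1 := by omega
  simpa [hbox, ← pow_mul, sq] using hcard

theorem sqrt_div_log_le_of_realizesAllSigns {H k : ℕ} (hH : 3 ≤ H) (hk : RealizesAllSigns H k) :
    1 / 4 * Real.sqrt ((H : ℝ) / Real.log H) ≤ k := by
  have h2 := two_pow_le_of_realizesAllSigns hk
  have hk1 : 1 ≤ k := by
    by_contra h0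
    obtain rfl : k = 0 := by omega
    have : 2 ^ 3 ≤ 2 ^ H := Nat.pow_le_pow_right (by norm_num) hH
    norm_num at h2
    omega
  have hkk : 1 ≤ k * k := Nat.mul_pos hk1 hk1
  have hbase : 2 * H + 1 ≤ H ^ 2 := by nlinarith
  have h3 : (2 * H + 1) ^ (k * k) + 1 ≤ (H ^ 2) ^ (2 * (k * k)) := by
    calc (2 * H + 1) ^ (k * k) + 1 ≤ (2 * H + 1) ^ (k * k) * (2 * H + 1) ^ (k * k) := by
          have : 2 ≤ (2 * H + 1) ^ (k * k) :=
            (by omega : 2 ≤ 2 * H + 1).trans (Nat.le_self_pow (by omega) _)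
          nlinarith
      _ = (2 * H + 1) ^ (2 * (k * k)) := by rw [two_mul (k * k), pow_add]
      _ ≤ _ := Nat.pow_le_pow_left hbase _
  have h4 : 2 ^ H ≤ H ^ (8 * (k * k)) := by
    refine (h2.trans (Nat.pow_le_pow_left h3 2)).trans (le_of_eq ?_)
    rw [← pow_mul, ← pow_mul]
    ring_nf
  have hHpos : (0 : ℝ) < H := by positivity
  have hlogH : 0 < Real.log H := Real.log_pos (by exact_mod_cast (by omega : 1 < H))
  have h5 : (H : ℝ) * Real.log 2 ≤ 8 * (k * k) * Real.log H := by
    have h6 : ((2 : ℝ) ^ H) ≤ (H : ℝ) ^ (8 * (k * k)) := by exact_mod_cast h4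
    have h7 := Real.log_le_log (by positivity) h6
    rw [Real.log_pow, Real.log_pow] at h7
    exact_mod_cast h7
  have hlog2 := Real.log_two_gt_d9
  have h8 : (H : ℝ) / Real.log H ≤ (4 * k) ^ 2 := by
    rw [div_le_iff₀ hlogH]
    nlinarith
  have h9 := Real.sqrt_le_iff.2 ⟨by positivity, h8⟩
  linarith

theorem theorem6 :
    ∃ c C : ℝ, 0 < c ∧ 0 < C ∧ ∀ H : ℕ, 3 ≤ H →
      IsLeast {k : ℕ | RealizesAllSigns H k} (kappa H) ∧
      c * Real.sqrt ((H : ℝ) / Real.log (H : ℝ)) ≤ (kappa H : ℝ) ∧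
      (kappa H : ℝ) ≤ C * (H : ℝ) := by
  refine ⟨1 / 4, 70, by norm_num, by norm_num, fun H hH => ?_⟩
  have hne : {k : ℕ | RealizesAllSigns H k}.Nonempty := ⟨_, realizesAllSigns_linear H⟩
  have hmem : RealizesAllSigns H (kappa H) := Nat.sInf_mem hne
  refine ⟨⟨hmem, fun k hk => Nat.sInf_le hk⟩, sqrt_div_log_le_of_realizesAllSigns hH hmem, ?_⟩
  have h1 : kappa H ≤ 35 * (H + 1) := Nat.sInf_le (realizesAllSigns_linear H)
  exact_mod_cast (by omega : kappa H ≤ 70 * H)
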